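/- Let $M$ be an $n$-dimensional smooth manifold (Hausdorff and second countable, without boundary), for instance any smooth Riemannian manifold of dimension $n$, and let $f=(f_1,\dots,f_m): M\to\mathbb{R}^m$ be a smooth map, where $m<n$. Suppose that $0$ is a regular value of $f$ (that is, the differential $df_\xi$ is surjective for every $\xi\in f^{-1}(0)$), and let $K\subseteq f^{-1}(0)$ be a compact (connected) component of $f^{-1}(0)$. Then $K$ is an $(n-m)$-dimensional embedded smooth submanifold of $M$ and, with respect to its smooth structure as an embedded submanifold, there exist an open neighbourhood $V$ of $K$ in $M$, an open neighbourhood $U$ of $0$ in $\mathbb{R}^m$, and a diffeomorphism $\Gamma: V\to U\times K$ such that $$\pi_U\circ\Gamma=f|_V,$$ where $\pi_U: U\times K\to U$ is the projection onto the first factor and $f|_V$ is the restriction of $f$ to $V$. -/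

import Mathlib

open scoped Manifold ContDiff

/-- `q` is a regular value of `f : M → ℝᵐ`, where `M` is a manifold modelled on `ℝⁿ`: the
differential of `f` is surjective at every point of the level set `f ⁻¹ (q)`. -/
def IsRegularValue (n : ℕ) {m : ℕ} {M : Type*} [TopologicalSpace M]
    [ChartedSpace (EuclideanSpace ℝ (Fin n)) M]
    (f : M → EuclideanSpace ℝ (Fin m)) (q : EuclideanSpace ℝ (Fin m)) : Prop :=
  ∀ x : M, f x = q → Function.Surjective (mfderiv (𝓡 n) (𝓡 m) f x)

/-- `K` is a (connected) component of the subset `S` of a topological space: a maximal nonempty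
connected subset of `S` (Mathlib's `IsConnected` includes nonemptiness). -/
def IsComponentOf {X : Type*} [TopologicalSpace X] (K S : Set X) : Prop :=
  Maximal (fun C : Set X => C ⊆ S ∧ IsConnected C) K

/-- The smooth structure given by the atlas on the subset `K` (with its subspace topology) makes
`K` a `k`-dimensional embedded smooth submanifold of the `n`-dimensional manifold `M`: it is a
smooth manifold structure for which the inclusion `K → M` is a smooth embedding. -/
structure IsEmbeddedSubmanifold (n : ℕ) {M : Type*} [TopologicalSpace M]
    [ChartedSpace (EuclideanSpace ℝ (Fin n)) M] (k : ℕ) (K : Set M)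
    [ChartedSpace (EuclideanSpace ℝ (Fin k)) K] : Prop where
  isManifold : IsManifold (𝓡 k) ∞ K
  isSmoothEmbedding : Manifold.IsSmoothEmbedding (𝓡 k) (𝓡 n) ∞ (Subtype.val : K → M)

/-! Near a point of `K`, surjectivity of the differential and the inverse function theorem give
coordinates `ψ = (f, p)` on `M`. Slices of small balls are connected, so after shrinking, `K` is the
whole slice `f = 0` (`IsComponentOf.exists_isSliceChart`). Restricting `p` to `K` gives charts of
`K`, hence the embedded structure.

For the product structure, a smooth retraction `r` of a neighbourhood of `K` onto `K` suffices. It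
is built without a metric or a tubular neighbourhood, one slice chart at a time over a finite cover,
interpolating with bump functions in slice coordinates (`IsRetractionOn.exists_extend`). In slice
coordinates the differential of `(f, r)` along `K` is triangular with identity diagonal blocks, so
`(f, r)` is a local diffeomorphism there. It is injective on `K`, hence near `K` by compactness, and
the tube lemma finds `U × K` inside its image. -/

/-! ### Inverse function theorem and linear algebra. -/

section LocalInverse

variable {E E' : Type*} [NormedAddCommGroup E] [NormedSpace ℝ E] [CompleteSpace E]
  [NormedAddCommGroup E'] [NormedSpace ℝ E']

/-- The inverse function theorem for a smooth map on an open set, with an inverse which is smooth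
on the whole target. -/
theorem ContDiffOn.exists_openPartialHomeomorph {g : E → E'} {s : Set E} {a : E}
    (hs : IsOpen s) (ha : a ∈ s) (hg : ContDiffOn ℝ ∞ g s) (e : E ≃L[ℝ] E')
    (he : HasFDerivAt g (e : E →L[ℝ] E') a) :
    ∃ φ : OpenPartialHomeomorph E E', a ∈ φ.source ∧ φ.source ⊆ s ∧ (∀ x, φ x = g x) ∧
      ContDiffOn ℝ ∞ φ φ.source ∧ ContDiffOn ℝ ∞ φ.symm φ.target := by
  have hga : ContDiffAt ℝ ∞ g a := hg.contDiffAt (hs.mem_nhds ha)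
  set φ₀ := hga.toOpenPartialHomeomorph g he (by simp)
  have hcont : ContinuousOn (fderiv ℝ g) s := hg.continuousOn_fderiv_of_isOpen hs (by simp)
  -- Invertibility of the derivative is an open condition; imposing it on the source makes the
  -- inverse smooth at every point of the target, not only at `g a`.
  set u : Set E := s ∩ fderiv ℝ g ⁻¹' Set.range ((↑) : (E ≃L[ℝ] E') → E →L[ℝ] E')
  have hu : IsOpen u := hcont.isOpen_inter_preimage hs ContinuousLinearEquiv.isOpen
  have hcoe : ∀ x, (φ₀.restrOpen u hu) x = g x := fun x ↦ rfl
  refine ⟨φ₀.restrOpen u hu, ?_, ?_, hcoe, ?_, ?_⟩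
  · refine ⟨hga.mem_toOpenPartialHomeomorph_source he (by simp), ha, e, ?_⟩
    exact he.fderiv.symm
  · exact fun x hx ↦ hx.2.1
  · exact (hg.mono fun x hx ↦ hx.2.1).congr fun x _ ↦ hcoe x
  · intro y hy
    have hy' := (φ₀.restrOpen u hu).map_target hy
    obtain ⟨-, hys, e', he'⟩ := hy'
    refine ((φ₀.restrOpen u hu).contDiffAt_symm (f₀' := e') hy ?_ ?_).contDiffWithinAt
    · rw [he']
      exact ((hg.contDiffAt (hs.mem_nhds hys)).differentiableAt (by simp)).hasFDerivAt
    · exact hg.contDiffAt (hs.mem_nhds hys)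

end LocalInverse

section Linear

variable {E F G : Type*} [NormedAddCommGroup E] [NormedSpace ℝ E] [FiniteDimensional ℝ E]
  [NormedAddCommGroup F] [NormedSpace ℝ F]
  [NormedAddCommGroup G] [NormedSpace ℝ G] [FiniteDimensional ℝ G]

/-- A surjective linear map extends to a linear equivalence with a product. -/
theorem ContinuousLinearMap.exists_equiv_prod_of_surjective (A : E →L[ℝ] F)
    (hA : Function.Surjective A)
    (hdim : Module.finrank ℝ E = Module.finrank ℝ F + Module.finrank ℝ G) :
    ∃ e : E ≃L[ℝ] F × G, ∀ v, (e v).1 = A v := by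
  have hrank := A.toLinearMap.finrank_range_add_finrank_ker
  have hr : A.toLinearMap.range = ⊤ := LinearMap.range_eq_top.2 hA
  rw [hr, finrank_top] at hrank
  obtain ⟨q, hq⟩ := A.toLinearMap.ker.exists_isCompl
  let l : A.toLinearMap.ker ≃ₗ[ℝ] G := LinearEquiv.ofFinrankEq _ _ (by omega)
  let P : E →ₗ[ℝ] G := l.toLinearMap ∘ₗ A.toLinearMap.ker.projectionOnto q hq
  have hP : P.range = ⊤ := by
    rw [LinearMap.range_eq_top]
    exact l.surjective.comp (Submodule.projectionOnto_surjective hq)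
  have hker : P.ker = q := by
    rw [LinearMap.ker_comp_of_ker_eq_bot _ l.ker, Submodule.ker_projectionOnto]
  exact ⟨(LinearMap.equivProdOfSurjectiveOfIsCompl A.toLinearMap P hr hP
    (hker ▸ hq)).toContinuousLinearEquiv, fun v ↦ rfl⟩

end Linear

theorem IsComponentOf.subset_of_isPreconnected {X : Type*} [TopologicalSpace X] {K S C : Set X}
    (hK : IsComponentOf K S) {x : X} (hxK : x ∈ K) (hxC : x ∈ C) (hCS : C ⊆ S)
    (hC : IsPreconnected C) : C ⊆ K := by
  have h : IsConnected (K ∪ C) :=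
    ⟨⟨x, Or.inl hxK⟩, hK.prop.2.isPreconnected.union x hxK hxC hC⟩
  exact Set.subset_union_right.trans
    (hK.le_of_ge (y := K ∪ C) ⟨Set.union_subset hK.prop.1 hCS, h⟩ Set.subset_union_left)

/-! ### Slice charts: coordinates in which `K` is the zero slice of `f`. -/

section SliceChart

variable {E F G : Type*} [NormedAddCommGroup E] [NormedSpace ℝ E]
  [NormedAddCommGroup F] [NormedSpace ℝ F] [NormedAddCommGroup G] [NormedSpace ℝ G]
  {M : Type*} [TopologicalSpace M] [ChartedSpace E M]

/-- A chart straightening `f` to the first projection, in which `K` is the zero slice. -/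
structure IsSliceChart (E : Type*) [NormedAddCommGroup E] [NormedSpace ℝ E]
    {M : Type*} [TopologicalSpace M] [ChartedSpace E M]
    (f : M → F) (K : Set M) (ψ : OpenPartialHomeomorph M (F × G)) : Prop where
  contMDiffOn : ContMDiffOn 𝓘(ℝ, E) 𝓘(ℝ, F × G) ∞ ψ ψ.source
  contMDiffOn_symm : ContMDiffOn 𝓘(ℝ, F × G) 𝓘(ℝ, E) ∞ ψ.symm ψ.target
  fst_eq : ∀ y ∈ ψ.source, (ψ y).1 = f y
  mem_iff : ∀ y ∈ ψ.source, y ∈ K ↔ f y = 0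

/-- Near a point where its differential is surjective, a smooth map is the first projection in
suitable coordinates. -/
theorem ContMDiff.exists_straightening [IsManifold 𝓘(ℝ, E) ∞ M] [FiniteDimensional ℝ E]
    [FiniteDimensional ℝ G]
    (hdim : Module.finrank ℝ E = Module.finrank ℝ F + Module.finrank ℝ G)
    {f : M → F} (hf : ContMDiff 𝓘(ℝ, E) 𝓘(ℝ, F) ∞ f) {x : M}
    (hx : Function.Surjective (mfderiv 𝓘(ℝ, E) 𝓘(ℝ, F) f x)) :
    ∃ ψ : OpenPartialHomeomorph M (F × G), x ∈ ψ.source ∧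
      ContMDiffOn 𝓘(ℝ, E) 𝓘(ℝ, F × G) ∞ ψ ψ.source ∧
      ContMDiffOn 𝓘(ℝ, F × G) 𝓘(ℝ, E) ∞ ψ.symm ψ.target ∧ ∀ y ∈ ψ.source, (ψ y).1 = f y := by
  have : CompleteSpace E := FiniteDimensional.complete ℝ E
  set c := chartAt E x
  have hxc : x ∈ c.source := mem_chart_source E x
  have hcx : c x ∈ c.target := c.map_source hxc
  have hc : ContMDiffOn 𝓘(ℝ, E) 𝓘(ℝ, E) ∞ c c.source := contMDiffOn_chart
  have hcs : ContMDiffOn 𝓘(ℝ, E) 𝓘(ℝ, E) ∞ c.symm c.target := contMDiffOn_chart_symm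
  have hfc : ContDiffOn ℝ ∞ (f ∘ c.symm) c.target :=
    contMDiffOn_iff_contDiffOn.1 (hf.comp_contMDiffOn hcs)
  have hx' : Function.Surjective (fderiv ℝ (f ∘ c.symm) (c x)) := by
    have hd := (hf.mdifferentiableAt (x := x) (by simp)).mfderiv
    have hw : fderivWithin ℝ (writtenInExtChartAt 𝓘(ℝ, E) 𝓘(ℝ, F) x f) (Set.range 𝓘(ℝ, E))
        (extChartAt 𝓘(ℝ, E) x x) = fderiv ℝ (f ∘ c.symm) (c x) := by
      simp [writtenInExtChartAt, c, fderivWithin_univ, Function.comp_def]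
      rfl
    rw [← hw]
    exact fun v ↦ (hx v).imp fun w h ↦ (DFunLike.congr_fun hd w).symm.trans h
  obtain ⟨e, he⟩ := ContinuousLinearMap.exists_equiv_prod_of_surjective (G := G) _ hx' hdim
  let P : E →L[ℝ] G := (ContinuousLinearMap.snd ℝ F G).comp (e : E →L[ℝ] F × G)
  let g : E → F × G := fun y ↦ (f (c.symm y), P y)
  have hg : ContDiffOn ℝ ∞ g c.target := hfc.prodMk P.contDiff.contDiffOn
  have hge : HasFDerivAt g (e : E →L[ℝ] F × G) (c x) := by
    have h1 := (((hfc.contDiffAt (c.open_target.mem_nhds hcx)).differentiableAt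
      (by simp)).hasFDerivAt).prodMk (P.hasFDerivAt (x := c x))
    refine h1.congr_fderiv ?_
    ext v
    · exact (he v).symm
    · rfl
  obtain ⟨φ, hxφ, hφs, hφ, hφd, hφd'⟩ :=
    hg.exists_openPartialHomeomorph c.open_target hcx e hge
  refine ⟨c.trans φ, ⟨hxc, hxφ⟩, ?_, ?_, ?_⟩
  · exact (contMDiffOn_iff_contDiffOn.2 hφd).comp (hc.mono fun y hy ↦ hy.1) fun y hy ↦ hy.2
  · exact hcs.comp ((contMDiffOn_iff_contDiffOn.2 hφd').mono fun y hy ↦ hy.1) fun y hy ↦ hy.2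
  · intro y hy
    have : (c.trans φ) y = g (c y) := hφ _
    rw [this]
    exact congrArg f (c.left_inv hy.1)

/-- A component of a level set need not be open in it in general. Here it is: the zero slice of a
small ball is connected, lies in the level set and meets `K`, so maximality puts it inside `K`. -/
theorem IsComponentOf.exists_isSliceChart [IsManifold 𝓘(ℝ, E) ∞ M] [FiniteDimensional ℝ E]
    [FiniteDimensional ℝ G]
    (hdim : Module.finrank ℝ E = Module.finrank ℝ F + Module.finrank ℝ G)
    {f : M → F} (hf : ContMDiff 𝓘(ℝ, E) 𝓘(ℝ, F) ∞ f) {K : Set M}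
    (hK : IsComponentOf K (f ⁻¹' {0})) {x : M} (hxK : x ∈ K)
    (hx : Function.Surjective (mfderiv 𝓘(ℝ, E) 𝓘(ℝ, F) f x)) :
    ∃ ψ : OpenPartialHomeomorph M (F × G), x ∈ ψ.source ∧ IsSliceChart E f K ψ := by
  obtain ⟨ψ, hxψ, hd, hd', hfst⟩ := hf.exists_straightening (G := G) hdim hx
  have hfx : f x = 0 := hK.prop.1 hxK
  have hψx : ψ x = (0, (ψ x).2) := Prod.ext ((hfst x hxψ).trans hfx) rfl
  -- Balls for the sup metric are products, so the zero slice of this one is the ball `B` of `G`,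
  -- which is convex.
  obtain ⟨ε, hε, hball⟩ := Metric.isOpen_iff.1 ψ.open_target _ (ψ.map_source hxψ)
  let u : Set M := ψ.source ∩ ψ ⁻¹' Metric.ball (ψ x) ε
  have hu : IsOpen u := ψ.isOpen_inter_preimage Metric.isOpen_ball
  let B : Set G := Metric.ball (ψ x).2 ε
  have hBt : ∀ t ∈ B, ((0 : F), t) ∈ ψ.target := fun t ht ↦ hball <| by
    rw [hψx, Metric.mem_ball, Prod.dist_eq]
    simpa [hε] using Metric.mem_ball.1 ht
  let C : Set M := (fun t : G ↦ ψ.symm (0, t)) '' B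
  have hC : IsPreconnected C :=
    (convex_ball _ _).isPreconnected.image _
      (ψ.continuousOn_symm.comp (by fun_prop) fun t ht ↦ hBt t ht)
  have hxC : x ∈ C := ⟨(ψ x).2, Metric.mem_ball_self hε, by
    simp only; rw [← hψx, ψ.left_inv hxψ]⟩
  have hCK : C ⊆ K := by
    refine hK.subset_of_isPreconnected hxK hxC ?_ hC
    rintro _ ⟨t, ht, rfl⟩
    have h := hBt t ht
    simp only [Set.mem_preimage, Set.mem_singleton_iff]
    rw [← hfst _ (ψ.map_target h), ψ.right_inv h]
  refine ⟨ψ.restrOpen u hu, ⟨hxψ, hxψ, Metric.mem_ball_self hε⟩, ?_, ?_, ?_, ?_⟩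
  · exact hd.mono fun y hy ↦ hy.1
  · exact hd'.mono fun y hy ↦ hy.1
  · exact fun y hy ↦ hfst y hy.1
  · intro y hy
    refine ⟨fun h ↦ hK.prop.1 h, fun h ↦ hCK ⟨(ψ y).2, ?_, ?_⟩⟩
    · have h2 := hy.2.2
      rw [Set.mem_preimage, Metric.mem_ball, Prod.dist_eq] at h2
      exact (le_max_right _ _).trans_lt h2
    · have : ψ y = (0, (ψ y).2) := Prod.ext ((hfst y hy.1).trans h) rfl
      simp only
      rw [← this, ψ.left_inv hy.1]

namespace IsSliceChart

variable {f : M → F} {K : Set M} {ψ : OpenPartialHomeomorph M (F × G)}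

theorem apply_eq (h : IsSliceChart E f K ψ) {y : M} (hy : y ∈ ψ.source) (hyK : y ∈ K) :
    ψ y = (0, (ψ y).2) :=
  Prod.ext ((h.fst_eq y hy).trans ((h.mem_iff y hy).1 hyK)) rfl

theorem symm_zero_snd (h : IsSliceChart E f K ψ) {y : M} (hy : y ∈ ψ.source)
    (hyK : y ∈ K) : ψ.symm (0, (ψ y).2) = y := by
  rw [← h.apply_eq hy hyK, ψ.left_inv hy]

theorem zero_snd_mem_target (h : IsSliceChart E f K ψ) {y : M} (hy : y ∈ ψ.source)
    (hyK : y ∈ K) : (0, (ψ y).2) ∈ ψ.target := by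
  rw [← h.apply_eq hy hyK]
  exact ψ.map_source hy

theorem symm_zero_mem (h : IsSliceChart E f K ψ) {t : G} (ht : (0, t) ∈ ψ.target) :
    ψ.symm (0, t) ∈ K := by
  rw [h.mem_iff _ (ψ.map_target ht), ← h.fst_eq _ (ψ.map_target ht), ψ.right_inv ht]

theorem contMDiffOn_snd (h : IsSliceChart E f K ψ) :
    ContMDiffOn 𝓘(ℝ, E) 𝓘(ℝ, G) ∞ (fun y ↦ (ψ y).2) ψ.source :=
  (contDiff_snd (𝕜 := ℝ) (E := F) (F := G)).contMDiff.comp_contMDiffOn h.contMDiffOn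

omit [NormedSpace ℝ F] [NormedSpace ℝ G] in
theorem isOpen_zero_slice (ψ : OpenPartialHomeomorph M (F × G)) :
    IsOpen {t : G | ((0 : F), t) ∈ ψ.target} :=
  ψ.open_target.preimage (by fun_prop)

theorem contMDiffOn_symm_zero (h : IsSliceChart E f K ψ) :
    ContMDiffOn 𝓘(ℝ, G) 𝓘(ℝ, E) ∞ (fun t ↦ ψ.symm (0, t)) {t : G | ((0 : F), t) ∈ ψ.target} :=
  h.contMDiffOn_symm.comp
    (contDiff_const.prodMk contDiff_id :
      ContDiff ℝ ∞ fun t : G ↦ ((0 : F), t)).contMDiff.contMDiffOn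
    fun _ ht ↦ ht

end IsSliceChart

end SliceChart

/-! ### The embedded submanifold structure on `K`. -/

section Submanifold

variable {E F G : Type*} [NormedAddCommGroup E] [NormedSpace ℝ E]
  [NormedAddCommGroup F] [NormedSpace ℝ F] [NormedAddCommGroup G] [NormedSpace ℝ G]
  {M : Type*} [TopologicalSpace M] [ChartedSpace E M]
  {f : M → F} {K : Set M} {ψ : OpenPartialHomeomorph M (F × G)}

namespace IsSliceChart

open Classical in
/-- The chart of `K` induced by a slice chart. -/
noncomputable def restrict [Nonempty K] (h : IsSliceChart E f K ψ) :
    OpenPartialHomeomorph K G where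
  toFun y := (ψ y).2
  -- The value off the target is irrelevant; it is what `Nonempty K` is needed for.
  invFun t := if ht : (0, t) ∈ ψ.target then ⟨ψ.symm (0, t), h.symm_zero_mem ht⟩
    else Classical.arbitrary K
  source := Subtype.val ⁻¹' ψ.source
  target := {t | (0, t) ∈ ψ.target}
  map_source' y hy := h.zero_snd_mem_target hy y.2
  map_target' t ht := by
    have ht' : (0, t) ∈ ψ.target := ht
    simp only [dif_pos ht']
    exact ψ.map_target ht'
  left_inv' y hy := by
    simp only [dif_pos (h.zero_snd_mem_target hy y.2)]
    exact Subtype.ext (h.symm_zero_snd hy y.2)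
  right_inv' t ht := by
    have ht' : (0, t) ∈ ψ.target := ht
    simp only [dif_pos ht', ψ.right_inv ht']
  open_source := ψ.open_source.preimage continuous_subtype_val
  open_target := isOpen_zero_slice ψ
  continuousOn_toFun :=
    h.contMDiffOn_snd.continuousOn.comp continuous_subtype_val.continuousOn fun _ hy ↦ hy
  continuousOn_invFun := by
    rw [Topology.IsInducing.subtypeVal.continuousOn_iff]
    refine h.contMDiffOn_symm_zero.continuousOn.congr fun t ht ↦ ?_
    have ht' : (0, t) ∈ ψ.target := ht
    simp only [Function.comp_apply, dif_pos ht']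

open Classical in
theorem coe_restrict_symm [Nonempty K] (h : IsSliceChart E f K ψ) {t : G}
    (ht : t ∈ h.restrict.target) : (h.restrict.symm t : M) = ψ.symm (0, t) := by
  have ht' : (0, t) ∈ ψ.target := ht
  change ((if ht : (0, t) ∈ ψ.target then ⟨ψ.symm (0, t), h.symm_zero_mem ht⟩
    else Classical.arbitrary K : K) : M) = _
  rw [dif_pos ht']

end IsSliceChart

/-- The charted space structure on `K` given by a family of slice charts covering `K`. -/
noncomputable abbrev chartedSpaceOfIsSliceChart {ψ : K → OpenPartialHomeomorph M (F × G)}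
    (h : ∀ x, IsSliceChart E f K (ψ x)) (hψ : ∀ x : K, (x : M) ∈ (ψ x).source) :
    ChartedSpace G K where
  atlas := Set.range fun x ↦ haveI : Nonempty K := ⟨x⟩; (h x).restrict
  chartAt x := haveI : Nonempty K := ⟨x⟩; (h x).restrict
  mem_chart_source x := hψ x
  chart_mem_atlas x := ⟨x, rfl⟩

/-- A change of charts is `t ↦ (ψ_y (ψ_x⁻¹ (0, t))).2`, a composite of smooth maps passing through
`M`. -/
theorem isManifold_of_isSliceChart {ψ : K → OpenPartialHomeomorph M (F × G)}
    (h : ∀ x, IsSliceChart E f K (ψ x)) (hψ : ∀ x : K, (x : M) ∈ (ψ x).source) :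
    let _ := chartedSpaceOfIsSliceChart h hψ
    IsManifold 𝓘(ℝ, G) ∞ K := by
  let _ := chartedSpaceOfIsSliceChart h hψ
  refine isManifold_of_contDiffOn 𝓘(ℝ, G) ∞ K ?_
  rintro _ _ ⟨x, rfl⟩ ⟨y, rfl⟩
  have : Nonempty K := ⟨x⟩
  rw [← contMDiffOn_iff_contDiffOn]
  have hval : ∀ t ∈ (h x).restrict.target, ((h x).restrict.symm t : M) = (ψ x).symm (0, t) :=
    fun t ht ↦ (h x).coe_restrict_symm ht
  have hsub : ∀ t ∈ 𝓘(ℝ, G).symm ⁻¹' ((h x).restrict.symm.trans (h y).restrict).source ∩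
      Set.range 𝓘(ℝ, G), ((0 : F), t) ∈ (ψ x).target ∧ (ψ x).symm (0, t) ∈ (ψ y).source := by
    rintro t ⟨⟨ht, ht'⟩, -⟩
    refine ⟨ht, ?_⟩
    rw [← hval t ht]
    exact ht'
  refine ((h y).contMDiffOn_snd.comp ((h x).contMDiffOn_symm_zero.mono fun t ht ↦ (hsub t ht).1)
    fun t ht ↦ (hsub t ht).2).congr fun t ht ↦ ?_
  change (ψ y ((h x).restrict.symm t : M)).2 = _
  rw [hval t (hsub t ht).1]
  rfl

/-- In the charts `restrict` and `L ∘ ψ` the inclusion reads `t ↦ L (0, t)`, with `F` as complement.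
-/
theorem isSmoothEmbedding_of_isSliceChart {E F G : Type} [NormedAddCommGroup E]
    [NormedSpace ℝ E] [NormedAddCommGroup F] [NormedSpace ℝ F] [NormedAddCommGroup G]
    [NormedSpace ℝ G] [ChartedSpace E M] [IsManifold 𝓘(ℝ, E) ∞ M] (L : (F × G) ≃L[ℝ] E)
    {f : M → F} {ψ : K → OpenPartialHomeomorph M (F × G)}
    (h : ∀ x, IsSliceChart E f K (ψ x)) (hψ : ∀ x : K, (x : M) ∈ (ψ x).source) :
    let _ := chartedSpaceOfIsSliceChart h hψ
    Manifold.IsSmoothEmbedding 𝓘(ℝ, G) 𝓘(ℝ, E) ∞ (Subtype.val : K → M) := by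
  let _ := chartedSpaceOfIsSliceChart h hψ
  have := isManifold_of_isSliceChart h hψ
  refine ⟨⟨F, inferInstance, inferInstance, fun x ↦ ?_⟩, Topology.IsEmbedding.subtypeVal⟩
  have : Nonempty K := ⟨x⟩
  refine Manifold.IsImmersionAtOfComplement.mk_of_charts
    ((ContinuousLinearEquiv.prodComm ℝ G F).trans L) (h x).restrict
    ((ψ x).trans L.toHomeomorph.toOpenPartialHomeomorph) (hψ x) ⟨hψ x, trivial⟩
    (IsManifold.chart_mem_maximalAtlas x) ?_ (fun y hy ↦ ⟨hy, trivial⟩) ?_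
  · apply OpenPartialHomeomorph.mem_maximalAtlas_of_contMDiffOn
    · exact L.contDiff.contMDiff.comp_contMDiffOn ((h x).contMDiffOn.mono fun y hy ↦ hy.1)
    · exact (h x).contMDiffOn_symm.comp L.symm.contDiff.contMDiff.contMDiffOn fun y hy ↦ hy.2
  · intro t ht
    have ht' : t ∈ (h x).restrict.target := by simpa using ht
    have ht'' : (0, t) ∈ (ψ x).target := ht'
    change L (ψ x ((h x).restrict.symm t : M)) = L (0, t)
    rw [(h x).coe_restrict_symm ht', (ψ x).right_inv ht'']

end Submanifold

/-! ### A smooth retraction of a neighbourhood onto `K`. -/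

section Retraction

variable {E F G : Type*} [NormedAddCommGroup E] [NormedSpace ℝ E] [FiniteDimensional ℝ E]
  [NormedAddCommGroup F] [NormedSpace ℝ F] [NormedAddCommGroup G] [NormedSpace ℝ G]
  {M : Type*} [TopologicalSpace M] [ChartedSpace E M] [IsManifold 𝓘(ℝ, E) ∞ M]
  {f : M → F} {K : Set M}

/-- `r` is a smooth map on the open set `W` which retracts `W` onto `K ∩ W` within `K`. -/
structure IsRetractionOn (E : Type*) [NormedAddCommGroup E] [NormedSpace ℝ E]
    {M : Type*} [TopologicalSpace M] [ChartedSpace E M] (K W : Set M) (r : M → M) : Prop where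
  isOpen : IsOpen W
  contMDiffOn : ContMDiffOn 𝓘(ℝ, E) 𝓘(ℝ, E) ∞ r W
  mapsTo : Set.MapsTo r W K
  eq_self : ∀ x ∈ W, x ∈ K → r x = x

open Classical in
/-- A smooth retraction near a closed part `A` of `K` extends, after modification away from `A`,
over the domain of a slice chart, by interpolating in the coordinates of this chart. -/
theorem IsRetractionOn.exists_extend [T2Space M] [NormalSpace M] [SigmaCompactSpace M]
    {A W : Set M} {r : M → M}
    (hr : IsRetractionOn E K W r) (hA : IsClosed A) (hAW : A ⊆ W)
    {ψ : OpenPartialHomeomorph M (F × G)} (hψ : IsSliceChart E f K ψ) :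
    ∃ (W' : Set M) (r' : M → M), IsRetractionOn E K W' r' ∧ A ⊆ W' ∧ K ∩ ψ.source ⊆ W' := by
  obtain ⟨χ, hχ0, hχ1, -⟩ := exists_contMDiffMap_zero_one_nhds_of_isClosed 𝓘(ℝ, E) (n := (⊤ : ℕ∞))
    hr.isOpen.isClosed_compl hA (Set.disjoint_left.2 fun x hx hxA ↦ hx (hAW hxA))
  obtain ⟨Z, hZ, hWZ, hZχ⟩ := eventually_nhdsSet_iff_exists.1 hχ0
  obtain ⟨O, hO, hAO, hOχ⟩ := eventually_nhdsSet_iff_exists.1 hχ1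
  have hOZ : ∀ x ∈ O, x ∉ Z := fun x hx hxZ ↦ by
    have := (hZχ x hxZ).symm.trans (hOχ x hx)
    norm_num at this
  have hOW : O ⊆ W := fun x hx ↦ by_contra fun h ↦ hOZ x hx (hWZ h)
  let p : M → G := fun y ↦ (ψ y).2
  let s : G → M := fun t ↦ ψ.symm (0, t)
  let T : Set G := {t | ((0 : F), t) ∈ ψ.target}
  have hT : IsOpen T := IsSliceChart.isOpen_zero_slice ψ
  have hp : ContMDiffOn 𝓘(ℝ, E) 𝓘(ℝ, G) ∞ p ψ.source := hψ.contMDiffOn_snd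
  have hs : ContMDiffOn 𝓘(ℝ, G) 𝓘(ℝ, E) ∞ s T := hψ.contMDiffOn_symm_zero
  -- Interpolation between `r` (where `χ = 1`, near `A`) and the projection along the slice chart
  -- (where `χ = 0`, near the complement of `W`). Both fix `K`, so `b = p` on `K ∩ W`.
  let b : M → G := fun x ↦ χ x • p (r x) + (1 - χ x) • p x
  let O₂ : Set M := Z ∩ (ψ.source ∩ p ⁻¹' T)
  let D : Set M := (W ∩ r ⁻¹' ψ.source) ∩ ψ.source
  let O₃ : Set M := D ∩ b ⁻¹' T
  have hD : IsOpen D :=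
    (hr.contMDiffOn.continuousOn.isOpen_inter_preimage hr.isOpen ψ.open_source).inter
      ψ.open_source
  have hb : ContMDiffOn 𝓘(ℝ, E) 𝓘(ℝ, G) ∞ b D := by
    have h1 : ContMDiffOn 𝓘(ℝ, E) 𝓘(ℝ, G) ∞ (fun x ↦ p (r x)) D :=
      hp.comp (hr.contMDiffOn.mono fun x hx ↦ hx.1.1) fun x hx ↦ hx.1.2
    have h2 : ContMDiffOn 𝓘(ℝ, E) 𝓘(ℝ, G) ∞ p D := hp.mono fun x hx ↦ hx.2
    have h3 : ContMDiffOn 𝓘(ℝ, E) 𝓘(ℝ, ℝ) ∞ χ D := χ.contMDiff.contMDiffOn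
    exact (h3.smul h1).add ((contMDiffOn_const.sub h3).smul h2)
  have hO₂ : IsOpen O₂ := hZ.inter (hp.continuousOn.isOpen_inter_preimage ψ.open_source hT)
  have hO₃ : IsOpen O₃ := hb.continuousOn.isOpen_inter_preimage hD hT
  -- Smooth since it is given by `r`, `s ∘ p`, `s ∘ b` on the open sets `O`, `O₂`, `O₃`
  -- respectively. On `O ∩ O₃` one has `b = p ∘ r` and `s (p (r x)) = r x` because `r x ∈ K`; on `Z
  -- ∩ O₃`, `b = p`; `O` and `Z` are disjoint.
  let r' : M → M := fun x ↦ if x ∈ O then r x else if x ∈ Z then s (p x) else s (b x)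
  have e1 : ∀ x ∈ O, r' x = r x := fun x hx ↦ if_pos hx
  have e2 : ∀ x ∈ O₂, r' x = s (p x) := fun x hx ↦ by
    simp only [r', if_neg fun h ↦ hOZ x h hx.1, if_pos hx.1]
  have e3 : ∀ x ∈ O₃, r' x = s (b x) := fun x hx ↦ by
    by_cases hxO : x ∈ O
    · rw [e1 x hxO]
      simp only [b, hOχ x hxO, one_smul, sub_self, zero_smul, add_zero]
      exact (hψ.symm_zero_snd hx.1.1.2 (hr.mapsTo hx.1.1.1)).symm
    · by_cases hxZ : x ∈ Z
      · simp [r', hxO, hxZ, b, hZχ x hxZ]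
      · simp only [r', if_neg hxO, if_neg hxZ]
  have hb_eq : ∀ x ∈ W, x ∈ K → b x = p x := fun x hxW hxK ↦ by
    simp only [b, hr.eq_self x hxW hxK, ← add_smul, add_sub_cancel, one_smul]
  refine ⟨O ∪ O₂ ∪ O₃, r', ⟨(hO.union hO₂).union hO₃, ?_, ?_, ?_⟩, ?_, ?_⟩
  · refine ContMDiffOn.union_of_isOpen (ContMDiffOn.union_of_isOpen ?_ ?_ hO hO₂) ?_
      (hO.union hO₂) hO₃
    · exact (hr.contMDiffOn.mono hOW).congr e1
    · exact (hs.comp (hp.mono fun x hx ↦ hx.2.1) fun x hx ↦ hx.2.2).congr e2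
    · exact (hs.comp (hb.mono fun x hx ↦ hx.1) fun x hx ↦ hx.2).congr e3
  · rintro x ((hx | hx) | hx)
    · rw [e1 x hx]
      exact hr.mapsTo (hOW hx)
    · rw [e2 x hx]
      exact hψ.symm_zero_mem hx.2.2
    · rw [e3 x hx]
      exact hψ.symm_zero_mem hx.2
  · rintro x ((hx | hx) | hx) hxK
    · rw [e1 x hx, hr.eq_self x (hOW hx) hxK]
    · rw [e2 x hx]
      exact hψ.symm_zero_snd hx.2.1 hxK
    · rw [e3 x hx, hb_eq x hx.1.1.1 hxK]
      exact hψ.symm_zero_snd hx.1.2 hxK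
  · exact fun x hx ↦ Or.inl (Or.inl (hAO hx))
  · rintro x ⟨hxK, hxψ⟩
    have hpT : p x ∈ T := hψ.zero_snd_mem_target hxψ hxK
    by_cases hxW : x ∈ W
    · refine Or.inr ⟨⟨⟨hxW, ?_⟩, hxψ⟩, ?_⟩
      · rwa [Set.mem_preimage, hr.eq_self x hxW hxK]
      · rwa [Set.mem_preimage, hb_eq x hxW hxK]
    · exact Or.inl (Or.inr ⟨hWZ hxW, hxψ, hpT⟩)

/-- A compact set covered by slice charts is a smooth retract of a neighbourhood. -/
theorem exists_isRetractionOn [T2Space M] [SecondCountableTopology M] (hK : IsCompact K)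
    (h : ∀ x ∈ K, ∃ ψ : OpenPartialHomeomorph M (F × G), x ∈ ψ.source ∧ IsSliceChart E f K ψ) :
    ∃ (W : Set M) (r : M → M), IsRetractionOn E K W r ∧ K ⊆ W := by
  have : LocallyCompactSpace M := Manifold.locallyCompact_of_finiteDimensional 𝓘(ℝ, E)
  -- Closed neighbourhoods keep the part of `K` already treated closed, as the extension step
  -- requires.
  have hB : ∀ x ∈ K, ∃ B : Set M, IsClosed B ∧ B ∈ nhds x ∧
      ∃ ψ : OpenPartialHomeomorph M (F × G), B ⊆ ψ.source ∧ IsSliceChart E f K ψ := by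
    intro x hx
    obtain ⟨ψ, hxψ, hψ⟩ := h x hx
    obtain ⟨B, hBx, hBc, hB⟩ :=
      exists_mem_nhds_isClosed_subset (ψ.open_source.mem_nhds hxψ)
    exact ⟨B, hBc, hBx, ψ, hB, hψ⟩
  choose! B hBc hBx ψ hBψ hψ using hB
  obtain ⟨t, htK, htB⟩ := hK.elim_nhds_subcover B hBx
  have key : ∀ t : Finset M, (∀ x ∈ t, x ∈ K) →
      ∃ (W : Set M) (r : M → M), IsRetractionOn E K W r ∧ K ∩ ⋃ x ∈ t, B x ⊆ W := by
    classical
    intro t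
    induction t using Finset.induction_on with
    | empty =>
      exact fun _ ↦ ⟨∅, id, ⟨isOpen_empty, contMDiffOn_id, Set.mapsTo_empty _ _,
        fun x hx ↦ hx.elim⟩, by simp⟩
    | insert a t _ ih =>
      intro ht
      obtain ⟨W, r, hr, hW⟩ := ih fun x hx ↦ ht x (Finset.mem_insert_of_mem hx)
      have haK : a ∈ K := ht a (Finset.mem_insert_self _ _)
      have hcl : IsClosed (K ∩ ⋃ x ∈ t, B x) := hK.isClosed.inter <|
        t.finite_toSet.isClosed_biUnion fun x hx ↦ hBc x (ht x (Finset.mem_insert_of_mem hx))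
      obtain ⟨W', r', hr', h1, h2⟩ := hr.exists_extend hcl hW (hψ a haK)
      refine ⟨W', r', hr', ?_⟩
      rw [Finset.set_biUnion_insert, Set.inter_union_distrib_left]
      exact Set.union_subset (fun x hx ↦ h2 ⟨hx.1, hBψ a haK hx.2⟩) h1
  obtain ⟨W, r, hr, hW⟩ := key t htK
  exact ⟨W, r, hr, fun x hx ↦ hW ⟨hx, htB hx⟩⟩

end Retraction

/-! ### The map `(f, ρ)` near a point of `K`. -/

section LocalTriviality

variable {E F G : Type*} [NormedAddCommGroup E] [NormedSpace ℝ E]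
  [NormedAddCommGroup F] [NormedSpace ℝ F] [NormedAddCommGroup G] [NormedSpace ℝ G]
  {M : Type*} [TopologicalSpace M] [ChartedSpace E M]
  {f : M → F} {K : Set M} [ChartedSpace G K]

theorem IsSliceChart.contMDiffOn_restrict [Nonempty K] {ψ : OpenPartialHomeomorph M (F × G)}
    (hψ : IsSliceChart E f K ψ) (hι : ContMDiff 𝓘(ℝ, G) 𝓘(ℝ, E) ∞ (Subtype.val : K → M)) :
    ContMDiffOn 𝓘(ℝ, G) 𝓘(ℝ, G) ∞ hψ.restrict hψ.restrict.source :=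
  hψ.contMDiffOn_snd.comp hι.contMDiffOn fun _ hx ↦ hx

/-- The structure on `K` is arbitrary here, not the one built from slice charts. A continuous map
into `K` is smooth once its composite with the immersion into `M` is, so `restrict` is a
diffeomorphism for any such structure. -/
theorem IsSliceChart.contMDiffOn_restrict_symm [Nonempty K]
    {ψ : OpenPartialHomeomorph M (F × G)} (hψ : IsSliceChart E f K ψ)
    (hι : Manifold.IsImmersion 𝓘(ℝ, G) 𝓘(ℝ, E) ∞ (Subtype.val : K → M)) :
    ContMDiffOn 𝓘(ℝ, G) 𝓘(ℝ, G) ∞ hψ.restrict.symm hψ.restrict.target := by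
  intro t ht
  refine ContMDiffAt.contMDiffWithinAt
    ((ContMDiffAt.iff_comp_isImmersionAt (hι.isImmersionAt _)).2
      ⟨hψ.restrict.continuousAt_symm ht, ?_⟩)
  have hnhds := hψ.restrict.open_target.mem_nhds ht
  refine (hψ.contMDiffOn_symm_zero.contMDiffAt hnhds).congr_of_eventuallyEq ?_
  filter_upwards [hnhds] with t' ht' using hψ.coe_restrict_symm ht'

/-- If `ρ` is a smooth retraction onto `K`, then `(f, ρ)` is a local diffeomorphism at the points
of `K`. -/
theorem IsSliceChart.isLocalDiffeomorphAt_prodMk [CompleteSpace F] [CompleteSpace G]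
    {ψ : OpenPartialHomeomorph M (F × G)}
    (hψ : IsSliceChart E f K ψ)
    (hι : Manifold.IsImmersion 𝓘(ℝ, G) 𝓘(ℝ, E) ∞ (Subtype.val : K → M))
    {W : Set M} {r : M → M} (hr : IsRetractionOn E K W r)
    {ρ : M → K} (hρ : ∀ y ∈ W, (ρ y : M) = r y) {x : M} (hx : x ∈ ψ.source) (hxK : x ∈ K)
    (hxW : x ∈ W) :
    IsLocalDiffeomorphAt 𝓘(ℝ, E) (𝓘(ℝ, F).prod 𝓘(ℝ, G)) ∞ (fun y ↦ (f y, ρ y)) x := by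
  have : Nonempty K := ⟨⟨x, hxK⟩⟩
  set σ := hψ.restrict
  let D : Set M := W ∩ r ⁻¹' ψ.source
  have hD : IsOpen D := hr.contMDiffOn.continuousOn.isOpen_inter_preimage hr.isOpen ψ.open_source
  let T : Set (F × G) := ψ.target ∩ ψ.symm ⁻¹' D
  have hT : IsOpen T := ψ.isOpen_inter_preimage_symm hD
  -- In slice coordinates `(f, ρ)` becomes `(u, t) ↦ (u, h (u, t))`, with `h (0, t) = t` since `r`
  -- fixes `K`.
  let h : F × G → G := fun z ↦ (ψ (r (ψ.symm z))).2
  have hh : ContDiffOn ℝ ∞ h T := by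
    rw [← contMDiffOn_iff_contDiffOn]
    refine hψ.contMDiffOn_snd.comp (hr.contMDiffOn.comp (hψ.contMDiffOn_symm.mono fun z hz ↦ hz.1)
      fun z hz ↦ hz.2.1) fun z hz ↦ hz.2.2
  have hψx : ψ x = (0, (ψ x).2) := hψ.apply_eq hx hxK
  have hxT : ψ x ∈ T := by
    refine ⟨ψ.map_source hx, ?_⟩
    rw [Set.mem_preimage, ψ.left_inv hx]
    exact ⟨hxW, by rwa [Set.mem_preimage, hr.eq_self x hxW hxK]⟩
  have hh0 : ∀ t : G, ((0 : F), t) ∈ T → h (0, t) = t := by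
    intro t ht
    have hK := hψ.symm_zero_mem ht.1
    simp only [h, hr.eq_self _ ht.2.1 hK, ψ.right_inv ht.1]
  have hdh : HasFDerivAt h (fderiv ℝ h (ψ x)) (ψ x) :=
    ((hh.contDiffAt (hT.mem_nhds hxT)).differentiableAt (by simp)).hasFDerivAt
  -- The differential is block triangular with identity diagonal blocks, hence invertible.
  let e : (F × G) ≃L[ℝ] F × G := (ContinuousLinearEquiv.refl ℝ F).skewProd
    (ContinuousLinearEquiv.refl ℝ G) ((fderiv ℝ h (ψ x)).comp (ContinuousLinearMap.inl ℝ F G))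
  have hinr : (fderiv ℝ h (ψ x)).comp (ContinuousLinearMap.inr ℝ F G)
      = ContinuousLinearMap.id ℝ G := by
    have h1 : HasFDerivAt (fun t : G ↦ h (0, t))
        ((fderiv ℝ h (ψ x)).comp (ContinuousLinearMap.inr ℝ F G)) (ψ x).2 := by
      rw [hψx] at hdh
      rw [hψx]
      exact hdh.comp _ (hasFDerivAt_prodMk_right (0 : F) (ψ x).2)
    refine h1.unique ((hasFDerivAt_id _).congr_of_eventuallyEq ?_)
    have hnhds : {t : G | ((0 : F), t) ∈ T} ∈ nhds (ψ x).2 := by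
      refine (hT.preimage (by fun_prop : Continuous fun t : G ↦ ((0 : F), t))).mem_nhds ?_
      rw [Set.mem_preimage, ← hψx]
      exact hxT
    filter_upwards [hnhds] with t ht using hh0 t ht
  have hge : HasFDerivAt (fun z : F × G ↦ (z.1, h z)) (e : F × G →L[ℝ] F × G) (ψ x) := by
    refine (hasFDerivAt_fst.prodMk hdh).congr_fderiv ?_
    ext v
    · rfl
    · simp [e]
    · simp [e]
    · have := DFunLike.congr_fun hinr v
      simpa [e, show ((0 : F), (0 : G)) = 0 from rfl] using this
  obtain ⟨φ, hxφ, hφT, hφ, hφd, hφd'⟩ := (contDiffOn_fst.prodMk hh).exists_openPartialHomeomorph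
    hT hxT e hge
  let Φ : OpenPartialHomeomorph M (F × K) :=
    (ψ.trans φ).trans ((OpenPartialHomeomorph.refl F).prod σ.symm)
  have hΦ : Set.EqOn (fun y ↦ (f y, ρ y)) Φ Φ.source := by
    intro y hy
    have hyT := hφT hy.1.2
    have hyW : y ∈ D := by simpa [ψ.left_inv hy.1.1] using hyT.2
    have hφy : φ (ψ y) = (f y, (ψ (r y)).2) := by
      rw [hφ, hψ.fst_eq y hy.1.1]
      simp only [h, ψ.left_inv hy.1.1]
    have hrK : (0, (ψ (r y)).2) ∈ ψ.target := hψ.zero_snd_mem_target hyW.2 (hr.mapsTo hyW.1)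
    change (f y, ρ y) = ((φ (ψ y)).1, σ.symm (φ (ψ y)).2)
    rw [hφy]
    refine Prod.ext rfl (Subtype.ext ?_)
    simp only
    rw [hρ y hyW.1, hψ.coe_restrict_symm hrK, hψ.symm_zero_snd hyW.2 (hr.mapsTo hyW.1)]
  have hσ : ContMDiffOn 𝓘(ℝ, G) 𝓘(ℝ, G) ∞ σ σ.source := hψ.contMDiffOn_restrict hι.contMDiff
  have hσ' : ContMDiffOn 𝓘(ℝ, G) 𝓘(ℝ, G) ∞ σ.symm σ.target := hψ.contMDiffOn_restrict_symm hι
  have hψφ : ContMDiffOn 𝓘(ℝ, E) 𝓘(ℝ, F × G) ∞ (φ ∘ ψ) Φ.source :=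
    (contMDiffOn_iff_contDiffOn.2 hφd).comp (hψ.contMDiffOn.mono fun y hy ↦ hy.1.1)
      fun y hy ↦ hy.1.2
  have hxΦ : x ∈ Φ.source := by
    refine ⟨⟨hx, hxφ⟩, trivial, ?_⟩
    change (0, (φ (ψ x)).2) ∈ ψ.target
    rw [hφ]
    simp only [h, ψ.left_inv hx, hr.eq_self x hxW hxK]
    exact hψ.zero_snd_mem_target hx hxK
  refine ⟨⟨Φ.toPartialEquiv, Φ.open_source, Φ.open_target, ?_, ?_⟩, hxΦ, hΦ⟩
  · refine ContMDiffOn.prodMk ?_ ?_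
    · exact contDiff_fst.contMDiff.comp_contMDiffOn hψφ
    · exact hσ'.comp (contDiff_snd.contMDiff.comp_contMDiffOn hψφ) fun y hy ↦ hy.2.2
  · have h1 : ContMDiffOn (𝓘(ℝ, F).prod 𝓘(ℝ, G)) 𝓘(ℝ, F × G) ∞
        (fun z : F × K ↦ (z.1, σ z.2)) Φ.target :=
      contMDiff_fst.contMDiffOn.prodMk_space
        (hσ.comp contMDiff_snd.contMDiffOn fun z hz ↦ hz.1.2)
    exact hψ.contMDiffOn_symm.comp ((contMDiffOn_iff_contDiffOn.2 hφd').comp h1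
      fun z hz ↦ hz.2.1) fun z hz ↦ hz.2.2

end LocalTriviality

/-! ### From local to global: injectivity near `K` and the product neighbourhood. -/

/-- An injective local diffeomorphism has a smooth inverse on its image, which is open. -/
theorem Set.InjOn.isOpen_image_and_contMDiffOn_invFunOn
    {E E' H H' N : Type*} [NormedAddCommGroup E] [NormedSpace ℝ E] [NormedAddCommGroup E']
    [NormedSpace ℝ E'] [TopologicalSpace H] [TopologicalSpace H'] {I : ModelWithCorners ℝ E H}
    {J : ModelWithCorners ℝ E' H'} {M : Type*} [TopologicalSpace M] [ChartedSpace H M]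
    [TopologicalSpace N] [ChartedSpace H' N] [Nonempty M] {Γ : M → N} {W : Set M}
    (hW : IsOpen W) (hinj : Set.InjOn Γ W) (hΓ : ∀ x ∈ W, IsLocalDiffeomorphAt I J ∞ Γ x) :
    IsOpen (Γ '' W) ∧ ContMDiffOn J I ∞ (Function.invFunOn Γ W) (Γ '' W) := by
  have key : ∀ x ∈ W, Γ '' W ∈ nhds (Γ x) ∧
      ContMDiffAt J I ∞ (Function.invFunOn Γ W) (Γ x) := by
    intro x hx
    obtain ⟨Φ, hxΦ, hΦ⟩ := hΓ x hx
    have hx' : Φ x ∈ Φ.target := Φ.map_source hxΦ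
    have hsymm : ContMDiffAt J I ∞ Φ.invFun (Φ x) :=
      Φ.contMDiffOn_invFun.contMDiffAt (Φ.open_target.mem_nhds hx')
    have hnhds : ∀ᶠ z in nhds (Φ x), z ∈ Φ.target ∧ Φ.invFun z ∈ W := by
      refine Filter.Eventually.and (Φ.open_target.mem_nhds hx')
        (hsymm.continuousAt.eventually_mem ?_)
      rw [show Φ.invFun (Φ x) = x from Φ.left_inv hxΦ]
      exact hW.mem_nhds hx
    have hinv : ∀ z, z ∈ Φ.target → Γ (Φ.invFun z) = z := fun z hz ↦
      (hΦ (Φ.map_target hz)).trans (Φ.right_inv hz)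
    rw [show Γ x = Φ x from hΦ hxΦ]
    constructor
    · filter_upwards [hnhds] with z hz using ⟨_, hz.2, hinv z hz.1⟩
    · refine hsymm.congr_of_eventuallyEq ?_
      filter_upwards [hnhds] with z hz
      have h := hinj.leftInvOn_invFunOn hz.2
      rwa [hinv z hz.1] at h
  constructor
  · rw [isOpen_iff_mem_nhds]
    rintro _ ⟨x, hx, rfl⟩
    exact (key x hx).1
  · rintro _ ⟨x, hx, rfl⟩
    exact (key x hx).2.contMDiffWithinAt

section Trivialization

variable {E F G : Type*} [NormedAddCommGroup E] [NormedSpace ℝ E] [FiniteDimensional ℝ E]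
  [NormedAddCommGroup F] [NormedSpace ℝ F] [CompleteSpace F]
  [NormedAddCommGroup G] [NormedSpace ℝ G] [CompleteSpace G]
  {M : Type*} [TopologicalSpace M] [T2Space M] [SecondCountableTopology M]
  [ChartedSpace E M] [IsManifold 𝓘(ℝ, E) ∞ M]
  {f : M → F} {K : Set M} [ChartedSpace G K]

/-- A smooth map is a product projection in a neighbourhood of a compact embedded submanifold
which is its zero set in slice charts. -/
theorem exists_diffeomorph_prod_of_isSliceChart (hK : IsCompact K) (hKne : K.Nonempty)
    (h : ∀ x ∈ K, ∃ ψ : OpenPartialHomeomorph M (F × G), x ∈ ψ.source ∧ IsSliceChart E f K ψ)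
    (hf : ContMDiff 𝓘(ℝ, E) 𝓘(ℝ, F) ∞ f)
    (hι : Manifold.IsImmersion 𝓘(ℝ, G) 𝓘(ℝ, E) ∞ (Subtype.val : K → M)) :
    ∃ (V : TopologicalSpace.Opens M) (U : TopologicalSpace.Opens F)
      (Γ : V ≃ₘ⟮𝓘(ℝ, E), 𝓘(ℝ, F).prod 𝓘(ℝ, G)⟯ (U × K)),
      K ⊆ (V : Set M) ∧ (0 : F) ∈ U ∧ ∀ x : V, ((Γ x).1 : F) = f x := by
  classical
  obtain ⟨W, r, hr, hKW⟩ := exists_isRetractionOn hK h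
  have hKn : Nonempty K := hKne.to_subtype
  have hMn : Nonempty M := ⟨hKne.some⟩
  have hKc : CompactSpace K := isCompact_iff_compactSpace.1 hK
  have hfK : ∀ x ∈ K, f x = 0 := fun x hx ↦ by
    obtain ⟨ψ, hxψ, hψ⟩ := h x hx
    exact (hψ.mem_iff x hxψ).1 hx
  let ρ : M → K := fun y ↦ if hy : y ∈ W then ⟨r y, hr.mapsTo hy⟩ else Classical.arbitrary K
  have hρ : ∀ y ∈ W, (ρ y : M) = r y := fun y hy ↦ by simp only [ρ, dif_pos hy]
  have hρK : ∀ x (hx : x ∈ K), ρ x = ⟨x, hx⟩ := fun x hx ↦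
    Subtype.ext ((hρ x (hKW hx)).trans (hr.eq_self x (hKW hx) hx))
  let Γ : M → F × K := fun y ↦ (f y, ρ y)
  have hΓ : ∀ x ∈ K, IsLocalDiffeomorphAt 𝓘(ℝ, E) (𝓘(ℝ, F).prod 𝓘(ℝ, G)) ∞ Γ x := fun x hx ↦ by
    obtain ⟨ψ, hxψ, hψ⟩ := h x hx
    exact hψ.isLocalDiffeomorphAt_prodMk hι hr hρ hxψ hx (hKW hx)
  let Ω : Set M := {x | IsLocalDiffeomorphAt 𝓘(ℝ, E) (𝓘(ℝ, F).prod 𝓘(ℝ, G)) ∞ Γ x}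
  have hΩ : IsOpen Ω := isOpen_iff_mem_nhds.2 fun x ⟨Φ, hx, hΦ⟩ ↦
    Filter.mem_of_superset (Φ.open_source.mem_nhds hx) fun y hy ↦ ⟨Φ, hy, hΦ⟩
  have hinjK : Set.InjOn Γ K := fun x hx y hy hxy ↦ by
    have h2 : ρ x = ρ y := congrArg Prod.snd hxy
    rw [hρK x hx, hρK y hy] at h2
    exact congrArg Subtype.val h2
  -- Injective on the compact set `K` and locally injective at its points, `Γ` is injective on a
  -- neighbourhood of `K`.
  obtain ⟨O, hO, hKO, hinjO⟩ := hinjK.exists_isOpen_superset hK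
    (fun x hx ↦ (hΓ x hx).contMDiffAt.continuousAt) fun x hx ↦ by
      obtain ⟨Φ, hxΦ, hΦ⟩ := hΓ x hx
      exact ⟨Φ.source, Φ.open_source.mem_nhds hxΦ, Φ.injOn.congr hΦ.symm⟩
  have hP : IsOpen (Ω ∩ O) := hΩ.inter hO
  have hinjP : Set.InjOn Γ (Ω ∩ O) := hinjO.mono Set.inter_subset_right
  obtain ⟨himg, hsmooth⟩ :=
    hinjP.isOpen_image_and_contMDiffOn_invFunOn hP fun x hx ↦ hx.1
  set g := Function.invFunOn Γ (Ω ∩ O)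
  have h0K : ({0} : Set F) ×ˢ (Set.univ : Set K) ⊆ Γ '' (Ω ∩ O) := by
    rintro ⟨u, k⟩ ⟨hu, -⟩
    refine ⟨k, ⟨hΓ k k.2, hKO k.2⟩, ?_⟩
    exact Prod.ext ((hfK k k.2).trans hu.symm) (hρK k k.2)
  obtain ⟨U, T, hU, -, h0U, hT, hUT⟩ :=
    generalized_tube_lemma isCompact_singleton isCompact_univ himg h0K
  have hUimg : ∀ u ∈ U, ∀ k : K, (u, k) ∈ Γ '' (Ω ∩ O) := fun u hu k ↦
    hUT ⟨hu, hT trivial⟩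
  -- Cutting down to the points over `U` makes the image of `V` under `Γ` exactly `U × K`.
  let V : TopologicalSpace.Opens M := ⟨(Ω ∩ O) ∩ f ⁻¹' U, hP.inter (hU.preimage hf.continuous)⟩
  let U' : TopologicalSpace.Opens F := ⟨U, hU⟩
  have hgV : ∀ u ∈ U, ∀ k : K, Γ (g (u, k)) = (u, k) ∧ g (u, k) ∈ V := fun u hu k ↦ by
    have h1 : Γ (g (u, k)) = (u, k) := Function.invFunOn_eq (hUimg u hu k)
    refine ⟨h1, Function.invFunOn_mem (hUimg u hu k), ?_⟩
    rwa [Set.mem_preimage, show f (g (u, k)) = u from congrArg Prod.fst h1]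
  refine ⟨V, U', ⟨⟨fun x ↦ (⟨f x, x.2.2⟩, ρ x), fun z ↦ ⟨g (z.1, z.2), (hgV z.1 z.1.2 z.2).2⟩,
    ?_, ?_⟩, ?_, ?_⟩, ?_, h0U rfl, fun x ↦ rfl⟩
  · exact fun x ↦ Subtype.ext (hinjP.leftInvOn_invFunOn x.2.1)
  · intro z
    have h1 := (hgV z.1 z.1.2 z.2).1
    exact Prod.ext (Subtype.ext (congrArg (fun w : F × K ↦ w.1) h1))
      (congrArg (fun w : F × K ↦ w.2) h1)
  · have hΓV : ContMDiff 𝓘(ℝ, E) (𝓘(ℝ, F).prod 𝓘(ℝ, G)) ∞ fun x : V ↦ Γ x := fun x ↦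
      x.2.1.1.contMDiffAt.comp x contMDiff_subtype_val.contMDiffAt
    refine ContMDiff.prodMk ?_ hΓV.snd
    exact (ContMDiff.subtypeVal_comp_iff U' _).1 hΓV.fst
  · refine (ContMDiff.subtypeVal_comp_iff V _).1 fun z ↦ ?_
    have h1 : ContMDiffAt (𝓘(ℝ, F).prod 𝓘(ℝ, G)) 𝓘(ℝ, E) ∞ g ((z.1 : F), z.2) :=
      hsmooth.contMDiffAt (himg.mem_nhds (hUimg z.1 z.1.2 z.2))
    have h2 : ContMDiff (𝓘(ℝ, F).prod 𝓘(ℝ, G)) (𝓘(ℝ, F).prod 𝓘(ℝ, G)) ∞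
        fun z : U' × K ↦ ((z.1 : F), z.2) :=
      (contMDiff_subtype_val.comp contMDiff_fst).prodMk contMDiff_snd
    have h3 : ContMDiffAt (𝓘(ℝ, F).prod 𝓘(ℝ, G)) 𝓘(ℝ, E) ∞
        (g ∘ fun z : U' × K ↦ ((z.1 : F), z.2)) z := ContMDiffAt.comp z h1 h2.contMDiffAt
    exact h3
  · intro x hx
    refine ⟨⟨hΓ x hx, hKO hx⟩, ?_⟩
    rw [Set.mem_preimage, hfK x hx]
    exact h0U rfl

end Trivialization

theorem mainTheorem3 {n m : ℕ} (hmn : m < n)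
    {M : Type*} [TopologicalSpace M] [T2Space M] [SecondCountableTopology M]
    [ChartedSpace (EuclideanSpace ℝ (Fin n)) M] [IsManifold (𝓡 n) ∞ M]
    (f : M → EuclideanSpace ℝ (Fin m)) (hf : ContMDiff (𝓡 n) (𝓡 m) ∞ f)
    (h0 : IsRegularValue n f 0)
    (K : Set M) (hK : IsComponentOf K (f ⁻¹' {0})) (hKc : IsCompact K) :
    (∃ _ : ChartedSpace (EuclideanSpace ℝ (Fin (n - m))) K, IsEmbeddedSubmanifold n (n - m) K) ∧
    ∀ [ChartedSpace (EuclideanSpace ℝ (Fin (n - m))) K], IsEmbeddedSubmanifold n (n - m) K →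
      ∃ (V : TopologicalSpace.Opens M) (U : TopologicalSpace.Opens (EuclideanSpace ℝ (Fin m)))
        (Γ : V ≃ₘ⟮𝓡 n, (𝓡 m).prod (𝓡 (n - m))⟯ (U × K)),
        K ⊆ (V : Set M) ∧ (0 : EuclideanSpace ℝ (Fin m)) ∈ U ∧
          ∀ x : V, ((Γ x).1 : EuclideanSpace ℝ (Fin m)) = f x := by
  have hdim : Module.finrank ℝ (EuclideanSpace ℝ (Fin n)) =
      Module.finrank ℝ (EuclideanSpace ℝ (Fin m)) +
        Module.finrank ℝ (EuclideanSpace ℝ (Fin (n - m))) := by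
    simp only [finrank_euclideanSpace_fin]
    omega
  have hslice : ∀ x ∈ K, ∃ ψ : OpenPartialHomeomorph M
      (EuclideanSpace ℝ (Fin m) × EuclideanSpace ℝ (Fin (n - m))),
      x ∈ ψ.source ∧ IsSliceChart (EuclideanSpace ℝ (Fin n)) f K ψ := fun x hx ↦
    hK.exists_isSliceChart hdim hf hx (h0 x (hK.prop.1 hx))
  constructor
  · choose ψ hψx hψ using fun x : K ↦ hslice x x.2
    let L : (EuclideanSpace ℝ (Fin m) × EuclideanSpace ℝ (Fin (n - m))) ≃L[ℝ]
        EuclideanSpace ℝ (Fin n) := ContinuousLinearEquiv.ofFinrankEq (by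
      rw [Module.finrank_prod, hdim])
    exact ⟨chartedSpaceOfIsSliceChart hψ hψx, @IsEmbeddedSubmanifold.mk _ _ _ _ _ _ (_)
      (isManifold_of_isSliceChart hψ hψx)
      (isSmoothEmbedding_of_isSliceChart L hψ hψx)⟩
  · intro inst hemb
    exact exists_diffeomorph_prod_of_isSliceChart hKc hK.prop.2.nonempty hslice hf
      hemb.isSmoothEmbedding.isImmersion
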